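/- Let $(\Omega,\mathcal F,\mathbf P)$ be a probability space, let $n\ge 1$ be an integer and $T>0$. Let $X(t)$, $t\ge 0$, be a random process in $\mathbf R^n$ with right continuous paths with left limits, such that $X_i(t)\ge 0$ a.s. for all $t$ and $i$ and $\mathbf E\sup_{t\in[0,T]}|X(t)|^2<+\infty$, and let $\{\mathcal F_t\}_{t\ge 0}$ be the filtration generated by $X$. Let $\Gamma_0\subset\mathbf R^n$ be a closed convex cone such that (a) if $x_i\le\widehat x_i$ for all $i$ and $\widehat x\in\Gamma_0$, then $x\in\Gamma_0$; (b) for every $x\in\Gamma_0$ and $j\in\{1,\dots,n\}$ there is $M>0$ with $x+Me_j\notin\Gamma_0$, where $e_j$ is the $j$-th coordinate vector. Let $\widehat g\in\mathbf R^n$ have positive components and let $\Gamma=\Gamma_0+\widehat g$. Assume that one of the following two cases holds: 1. $K=[0,L]^n$ with $L>0$, and $f(x,u,t)=u^\top x$; 2. $K=\mathbf R^n$ and $f(x,u,t)=u^\top x-u^\top Gu$, where $G$ is a symmetric positive definite matrix. For a stopping time $t$ with values in $[0,T]$ and an $\mathcal F_t$-measurable random vector $Y$ with values in $\Gamma$,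 let $U(t,Y)$ be the set of jointly measurable processes $u(s)$, $s\in[t,T]$, with values in $K$, which are adapted to $\{\mathcal F_s\}$, have a.s. integrable paths, and satisfy $Y+\int_t^Tu(s)\,ds\in\Gamma$ a.s. For $u\in U(t,Y)$ let $F(u,t)=\int_t^Tf(X(s),u(s),s)\,ds$, which takes values in $[-\infty,+\infty)$ a.s. and has an integrable positive part, and let $$J(t,Y)=\operatorname*{ess\,sup}_{u\in U(t,Y)}\mathbf E\{F(u,t)\mid\mathcal F_t\}.$$ Then for every such pair $(t,Y)$ there exists an optimal control $\bar u\in U(t,Y)$, that is, a control $\bar u\in U(t,Y)$ such that $J(t,Y)=\mathbf E\{F(\bar u,t)\mid\mathcal F_t\}$ a.s. In particular, $\mathbf E F(u,t)\le\mathbf E F(\bar u,t)$ for every $u\in U(t,Y)$. -/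

import Mathlib

open MeasureTheory Matrix
open scoped NNReal ENNReal

namespace SwingControl

/-- The state space `ℝⁿ` with the Euclidean norm. -/
abbrev Vec (n : ℕ) : Type := EuclideanSpace ℝ (Fin n)

/-- A path which is right continuous and has (finite) left limits. -/
def IsRCLL {n : ℕ} (x : ℝ≥0 → Vec n) : Prop :=
  ∀ t : ℝ≥0, ContinuousWithinAt x (Set.Ici t) t ∧
    ∃ l : Vec n, Filter.Tendsto x (nhdsWithin t (Set.Iio t)) (nhds l)

/-- The conditions on `Γ₀`: a closed convex cone, downward closed for the componentwise order,
which every ray in a positive coordinate direction eventually leaves. -/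
structure IsConstraintCone {n : ℕ} (Γ₀ : Set (Vec n)) : Prop where
  isClosed : IsClosed Γ₀
  convex : Convex ℝ Γ₀
  smul_mem : ∀ c : ℝ, 0 < c → ∀ x ∈ Γ₀, c • x ∈ Γ₀
  mem_of_le : ∀ x x' : Vec n, (∀ i, x i ≤ x' i) → x' ∈ Γ₀ → x ∈ Γ₀
  exists_notMem : ∀ x ∈ Γ₀, ∀ j : Fin n, ∃ M : ℝ, 0 < M ∧ x + EuclideanSpace.single j M ∉ Γ₀

/-- The constraint set `Γ = Γ₀ + g`. -/
def constraintSet {n : ℕ} (Γ₀ : Set (Vec n)) (g : Vec n) : Set (Vec n) :=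
  {y | ∃ x ∈ Γ₀, y = x + g}

/-- The linear case: `K = [0,L]ⁿ` with `L > 0`, and `f(x,u,t) = uᵀx`. -/
def IsLinearCase {n : ℕ} (K : Set (Vec n)) (f : Vec n → Vec n → ℝ≥0 → ℝ) : Prop :=
  ∃ L : ℝ, 0 < L ∧ K = {v | ∀ i, 0 ≤ v i ∧ v i ≤ L} ∧
    ∀ x u t, f x u t = u.ofLp ⬝ᵥ x.ofLp

/-- The quadratic case: `K = ℝⁿ` and `f(x,u,t) = uᵀx - uᵀGu` with `G` symmetric and
positive definite. -/
def IsQuadraticCase {n : ℕ} (K : Set (Vec n)) (f : Vec n → Vec n → ℝ≥0 → ℝ) : Prop :=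
  ∃ G : Matrix (Fin n) (Fin n) ℝ, G.PosDef ∧ K = Set.univ ∧
    ∀ x u t, f x u t = u.ofLp ⬝ᵥ x.ofLp - u.ofLp ⬝ᵥ (G *ᵥ u.ofLp)

/-- The extended integral `∫ g⁺ - ∫ g⁻` of an extended real function. It is the usual one whenever
`∫ g⁺` or `∫ g⁻` is finite (in `EReal`, `⊤ - ⊤ = ⊥`). -/
noncomputable def extIntegral {α : Type*} [MeasurableSpace α] (μ : Measure α) (g : α → EReal) :
    EReal :=
  ((∫⁻ a, (g a).toENNReal ∂μ : ℝ≥0∞) : EReal) - ((∫⁻ a, (-g a).toENNReal ∂μ : ℝ≥0∞) : EReal)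

/-- The extended conditional expectation `E[g⁺ | m] - E[g⁻ | m]` of an extended real random
variable, the two terms being conditional expectations of `[0,∞]`-valued functions. It is the usual
one whenever `g⁺` or `g⁻` is integrable. -/
noncomputable def extCondExp {Ω : Type*} {mΩ : MeasurableSpace Ω} (m : MeasurableSpace Ω)
    (P : Measure[mΩ] Ω) (g : Ω → EReal) : Ω → EReal := fun ω =>
  ((condLExp m P (fun ω' => (g ω').toENNReal) ω : ℝ≥0∞) : EReal) -
    ((condLExp m P (fun ω' => (-g ω').toENNReal) ω : ℝ≥0∞) : EReal)

/-- `g` is (a version of) the essential supremum of the family `S` of random variables. -/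
structure IsEssSupFamily {Ω : Type*} {mΩ : MeasurableSpace Ω} (P : Measure Ω)
    (S : Set (Ω → EReal)) (g : Ω → EReal) : Prop where
  measurable : Measurable g
  upper : ∀ h ∈ S, h ≤ᵐ[P] g
  least : ∀ g' : Ω → EReal, Measurable g' → (∀ h ∈ S, h ≤ᵐ[P] g') → g ≤ᵐ[P] g'

section Control

variable {Ω : Type*} {mΩ : MeasurableSpace Ω} {n : ℕ}

/-- The set `U(τ,Y)` of admissible controls. A control is a process `u(s,ω)`,
`τ(ω) ≤ s ≤ T`, with values in `K`, jointly measurable and adapted; its values for other `s` are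
irrelevant. Its paths are integrable on `[τ,T]` and `Y + ∫_τ^T u(s) ds ∈ Γ` almost surely. -/
structure IsAdmissible (P : Measure Ω) (𝓕 : Filtration ℝ≥0 mΩ) (T : ℝ≥0) (Γ K : Set (Vec n))
    (τ : Ω → ℝ≥0) (Y : Ω → Vec n) (u : ℝ≥0 → Ω → Vec n) : Prop where
  mem : ∀ ω s, τ ω ≤ s → s ≤ T → u s ω ∈ K
  measurable : Measurable
    ({p : ℝ≥0 × Ω | τ p.2 ≤ p.1 ∧ p.1 ≤ T}.indicator (fun p => u p.1 p.2))
  adapted : ∀ s ≤ T, Measurable[𝓕 s] ({ω | τ ω ≤ s}.indicator (u s))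
  integrableOn : ∀ᵐ ω ∂P,
    IntegrableOn (fun s : ℝ => u s.toNNReal ω) (Set.Icc (τ ω : ℝ) (T : ℝ))
  constraint : ∀ᵐ ω ∂P,
    (Y ω + ∫ s in Set.Icc (τ ω : ℝ) (T : ℝ), u s.toNNReal ω) ∈ Γ

/-- The payoff `F(u,τ) = ∫_τ^T f(X(s),u(s),s) ds`, an extended real random variable. -/
noncomputable def payoff (f : Vec n → Vec n → ℝ≥0 → ℝ) (X : ℝ≥0 → Ω → Vec n) (T : ℝ≥0)
    (τ : Ω → ℝ≥0) (u : ℝ≥0 → Ω → Vec n) : Ω → EReal := fun ω =>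
  extIntegral (volume.restrict (Set.Icc (τ ω : ℝ) (T : ℝ)))
    (fun s : ℝ => ((f (X s.toNNReal ω) (u s.toNNReal ω) s.toNNReal : ℝ) : EReal))

end Control

end SwingControl

namespace SwingControl

/-! In both cases the running payoff `φ x u` is concave in `u` and coercive: `c‖u‖² + φ x u ≤ C(1 +
‖x‖²)` on `K`. Write the payoff as `D - H`, where `D` is the time integral of `C(1 + ‖X‖²)`,
integrable and independent of the control, and `H ≥ 0` is the time integral of the loss. Maximizing
the payoff, in expectation or conditionally, is then minimizing the corresponding expectation of
`H`, and values `-∞` cause no trouble because only `H` can be infinite.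

The expected loss is convex on the convex set of controls and dominates `c` times the squared L²
norm; the zero control has finite loss. Near-minimizers that also nearly minimize the norm form a
Cauchy sequence by the parallelogram law (`exists_minimizing_cauchy`), so strong convergence is
obtained without weak compactness. At a geometric rate this gives almost everywhere convergence and,
for almost every `ω`, L¹ convergence in time. Adaptedness, values in `K` and the integral constraint
therefore survive (`IsControl.convLimit`), and Fatou's lemma shows that the limit is a minimizer
(`IsCoercivePayoff.exists_isMinOn`).

Optimality given `𝓕_τ` follows by gluing: switching to a competitor on a set of `𝓕_τ` gives another
control, so the minimizer has the smaller expected loss on every such set (`condLExp_loss_le`). Its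
conditional payoff is thus the largest of the family, hence its essential supremum. -/

/-! ### Extended-real differences, integrals and conditional expectations -/

theorem coe_sub_eq_coe_sub {a b d h : ℝ≥0∞} (ha : a ≠ ∞) (hd : d ≠ ∞) (e : a + h = d + b) :
    (a : EReal) - b = (d : EReal) - h := by
  by_cases hb : b = ∞
  · subst hb
    have hh : h = ∞ := by
      by_contra hh
      exact ENNReal.add_ne_top.2 ⟨ha, hh⟩ (by simpa using e)
    subst hh
    simp [sub_eq_add_neg]
  · have hh : h ≠ ∞ := by
      intro hh
      subst hh
      exact ENNReal.add_ne_top.2 ⟨hd, hb⟩ (by simpa using e.symm)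
    lift a to ℝ≥0 using ha
    lift b to ℝ≥0 using hb
    lift d to ℝ≥0 using hd
    lift h to ℝ≥0 using hh
    have e' : (a : ℝ) + h = d + b := by exact_mod_cast e
    have : (a : ℝ) - b = d - h := by linarith
    exact congrArg (fun x : ℝ => (x : EReal)) this

theorem toENNReal_coe_sub_add {p q : ℝ≥0∞} (hp : p ≠ ∞) :
    ((p : EReal) - q).toENNReal + q = p + (-((p : EReal) - q)).toENNReal := by
  by_cases hq : q = ∞
  · subst hq
    simp [sub_eq_add_neg]
  · lift p to ℝ≥0 using hp
    lift q to ℝ≥0 using hq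
    have h1 : ((p : ℝ≥0∞) : EReal) - ((q : ℝ≥0∞) : EReal) = (((p : ℝ) - q : ℝ) : EReal) := by
      rfl
    rw [h1, ← EReal.coe_neg, EReal.real_coe_toENNReal, EReal.real_coe_toENNReal,
      ← ENNReal.ofReal_coe_nnreal, ← ENNReal.ofReal_coe_nnreal]
    rcases le_total (p : ℝ) q with h | h
    · rw [ENNReal.ofReal_of_nonpos (by linarith : (p : ℝ) - q ≤ 0), zero_add,
        ← ENNReal.ofReal_add p.coe_nonneg (by linarith)]
      congr 1; ring
    · rw [ENNReal.ofReal_of_nonpos (by linarith : -((p : ℝ) - q) ≤ 0), add_zero,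
        ← ENNReal.ofReal_add (by linarith) q.coe_nonneg]
      congr 1; ring

theorem toENNReal_coe_sub (p q : ℝ≥0∞) : ((p : EReal) - q).toENNReal = p - q := by
  rw [EReal.toENNReal_sub (EReal.coe_ennreal_nonneg q), EReal.toENNReal_coe, EReal.toENNReal_coe]

/-- Any representation `g = d - h` with `d` integrable may replace the one by positive and negative
parts. The identity is written additively so that infinite values of `h` are allowed, and additivity
needs only one measurable summand on each side. -/
theorem extIntegral_eq_sub {α : Type*} [MeasurableSpace α] {μ : Measure α} {g : α → EReal}
    {d h : α → ℝ≥0∞} (hg : AEMeasurable (fun a => (g a).toENNReal) μ) (hd : AEMeasurable d μ)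
    (e : ∀ᵐ a ∂μ, (g a).toENNReal + h a = d a + (-g a).toENNReal)
    (hle : ∀ᵐ a ∂μ, (g a).toENNReal ≤ d a) (hfin : ∫⁻ a, d a ∂μ ≠ ∞) :
    extIntegral μ g = ((∫⁻ a, d a ∂μ : ℝ≥0∞) : EReal) - ((∫⁻ a, h a ∂μ : ℝ≥0∞) : EReal) := by
  refine coe_sub_eq_coe_sub (ne_top_of_le_ne_top hfin (lintegral_mono_ae hle)) hfin ?_
  rw [← lintegral_add_left' hg, ← lintegral_add_left' hd]
  exact lintegral_congr_ae e

theorem extCondExp_ae_eq_sub {Ω : Type*} {mΩ : MeasurableSpace Ω} (m : MeasurableSpace Ω)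
    {P : Measure[mΩ] Ω} {g : Ω → EReal} {d h : Ω → ℝ≥0∞}
    (hg : AEMeasurable (fun a => (g a).toENNReal) P) (hd : AEMeasurable d P)
    (e : ∀ᵐ a ∂P, (g a).toENNReal + h a = d a + (-g a).toENNReal)
    (hle : ∀ᵐ a ∂P, (g a).toENNReal ≤ d a) (hfin : ∫⁻ a, d a ∂P ≠ ∞) :
    ∀ᵐ ω ∂P, extCondExp m P g ω =
      ((condLExp m P d ω : ℝ≥0∞) : EReal) - ((condLExp m P h ω : ℝ≥0∞) : EReal) := by
  have e' : (fun a => (g a).toENNReal) + h =ᵐ[P] d + fun a => (-g a).toENNReal := e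
  filter_upwards [condLExp_ne_top (mΩ := m) hfin,
    condLExp_ne_top (mΩ := m) (ne_top_of_le_ne_top hfin (lintegral_mono_ae hle)),
    condLExp_congr_ae (mΩ := m) e', condLExp_add_left (mΩ := m) h hg,
    condLExp_add_left (mΩ := m) (fun a => (-g a).toENNReal) hd] with ω h1 h2 h3 h4 h5
  refine coe_sub_eq_coe_sub h2 h1 ?_
  simpa [h4, h5] using h3

theorem extCondExp_congr_ae {Ω : Type*} {mΩ : MeasurableSpace Ω} (m : MeasurableSpace Ω)
    {P : Measure[mΩ] Ω} {g g' : Ω → EReal} (h : g =ᵐ[P] g') :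
    extCondExp m P g =ᵐ[P] extCondExp m P g' := by
  filter_upwards [condLExp_congr_ae (mΩ := m) (h.fun_comp EReal.toENNReal),
    condLExp_congr_ae (mΩ := m) (h.fun_comp fun x => (-x).toENNReal)] with ω h1 h2
  simp only [Function.comp_def] at h1 h2
  simp only [extCondExp, h1, h2]

theorem extIntegral_congr_ae {α : Type*} [MeasurableSpace α] {μ : Measure α} {g g' : α → EReal}
    (h : g =ᵐ[μ] g') : extIntegral μ g = extIntegral μ g' := by
  have h1 := lintegral_congr_ae (h.fun_comp EReal.toENNReal)
  have h2 := lintegral_congr_ae (h.fun_comp fun x => (-x).toENNReal)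
  simp only [Function.comp_def] at h1 h2
  simp only [extIntegral, h1, h2]

theorem measurable_extCondExp {Ω : Type*} {mΩ : MeasurableSpace Ω} (m : MeasurableSpace Ω)
    (P : Measure[mΩ] Ω) (g : Ω → EReal) : Measurable[mΩ] (extCondExp m P g) := by
  have h1 := measurable_condLExp' m P (fun ω => (g ω).toENNReal)
  have h2 := measurable_condLExp' m P (fun ω => (-g ω).toENNReal)
  have hm : Measurable fun p : ℝ≥0∞ × ℝ≥0∞ => (p.1 : EReal) - (p.2 : EReal) := by
    -- Subtraction is discontinuous at `(∞, ∞)`, so measurability is read off from the explicit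
    -- cases.
    have : (fun p : ℝ≥0∞ × ℝ≥0∞ => (p.1 : EReal) - (p.2 : EReal)) =
        fun p => if p.2 = ∞ then ⊥ else if p.1 = ∞ then ⊤ else
          ((p.1.toReal - p.2.toReal : ℝ) : EReal) := by
      funext ⟨p, q⟩
      dsimp only
      split_ifs with h h'
      · simp [h, sub_eq_add_neg]
      · lift q to ℝ≥0 using h
        subst h'
        exact EReal.top_sub_coe _
      · lift q to ℝ≥0 using h
        lift p to ℝ≥0 using h'
        rfl
    rw [this]
    refine Measurable.ite (measurable_snd (measurableSet_singleton _)) measurable_const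
      (Measurable.ite (measurable_fst (measurableSet_singleton _)) measurable_const ?_)
    fun_prop
  exact hm.comp (h1.prodMk h2)

/-- Both conditional expectations are `m`-measurable, so the inequality can be tested on
`m`-measurable sets for the trimmed measure. -/
theorem condLExp_le_condLExp {Ω : Type*} {m mΩ : MeasurableSpace Ω} (hm : m ≤ mΩ)
    {P : Measure[mΩ] Ω} [IsFiniteMeasure P] {g h : Ω → ℝ≥0∞}
    (hle : ∀ s, MeasurableSet[m] s → ∫⁻ ω in s, g ω ∂P ≤ ∫⁻ ω in s, h ω ∂P) :
    condLExp m P g ≤ᵐ[P] condLExp m P h := by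
  refine ae_le_of_ae_le_trim (hm := hm) ?_
  refine ae_le_of_forall_setLIntegral_le_of_sigmaFinite (measurable_condLExp m P g) ?_
  intro s hs _
  rw [setLIntegral_condLExp_trim hm P g hs, setLIntegral_condLExp_trim hm P h hs]
  exact hle s hs

/-! ### Minimizing sequences and pointwise limits -/

/-- A quasiconvex functional `I` dominating a quadratic `N` has minimizing sequences which are
Cauchy for `N`, at any prescribed rate. -/
theorem exists_minimizing_cauchy {V : Type*} [AddCommGroup V] [Module ℝ V] {C : Set V}
    {I N : V → ℝ≥0∞} (hC : ∀ u ∈ C, ∀ v ∈ C, (1 / 2 : ℝ) • (u + v) ∈ C)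
    (hI : ∀ u ∈ C, ∀ v ∈ C, I ((1 / 2 : ℝ) • (u + v)) ≤ max (I u) (I v))
    (hN : ∀ u ∈ C, ∀ v ∈ C, N (u - v) + 4 * N ((1 / 2 : ℝ) • (u + v)) = 2 * N u + 2 * N v)
    {A : ℝ≥0∞} (hA : A ≠ ∞) (hNI : ∀ u ∈ C, N u ≤ A * I u) {u₀ : V} (hu₀ : u₀ ∈ C)
    (hIu₀ : I u₀ ≠ ∞) {δ : ℕ → ℝ≥0∞} (hδ : ∀ k, 0 < δ k) (hδa : Antitone δ) :
    ∃ u : ℕ → V, (∀ k, u k ∈ C) ∧ (∀ k, ∀ w ∈ C, I (u k) ≤ I w + δ k) ∧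
      ∀ k l, k ≤ l → N (u k - u l) ≤ δ k := by
  set m := ⨅ w ∈ C, I w with hm
  have hm_le : ∀ w ∈ C, m ≤ I w := fun w hw => iInf₂_le w hw
  have hm_top : m ≠ ∞ := ne_top_of_le_ne_top hIu₀ (hm_le _ hu₀)
  set S : ℝ≥0∞ → Set V := fun ε => {u | u ∈ C ∧ I u ≤ m + ε} with hS
  -- `R ε` is the infimum of `N` over the `ε`-minimizers. It grows as `ε` decreases to `0`, and its
  -- supremum `r` is at most `A * I u₀`, hence finite.
  set R : ℝ≥0∞ → ℝ≥0∞ := fun ε => ⨅ u ∈ S ε, N u with hR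
  have hR_le : ∀ ε, ∀ u ∈ S ε, R ε ≤ N u := fun ε u hu => iInf₂_le u hu
  have hne : ∀ ε, 0 < ε → ∃ u ∈ S ε, I u ≤ I u₀ := by
    intro ε hε
    by_cases h : I u₀ ≤ m + ε
    · exact ⟨u₀, ⟨hu₀, h⟩, le_rfl⟩
    · have : m < m + ε := ENNReal.lt_add_right hm_top hε.ne'
      obtain ⟨w, hw, hlt⟩ : ∃ w ∈ C, I w < m + ε := by
        simpa [hm, iInf_lt_iff] using this
      exact ⟨w, ⟨hw, hlt.le⟩, hlt.le.trans (not_le.1 h).le⟩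
  set r := ⨆ ε : {ε : ℝ≥0∞ // 0 < ε}, R ε with hr
  have hR_r : ∀ ε, 0 < ε → R ε ≤ r := fun ε hε =>
    le_iSup (fun ε : {ε : ℝ≥0∞ // 0 < ε} => R ε) ⟨ε, hε⟩
  have hr_top : r ≠ ∞ := by
    refine ne_top_of_le_ne_top (ENNReal.mul_ne_top hA hIu₀) (iSup_le ?_)
    rintro ⟨ε, hε⟩
    obtain ⟨u, hu, hle⟩ := hne ε hε
    exact (hR_le _ _ hu).trans ((hNI u hu.1).trans (by gcongr))
  have hRanti : Antitone R := fun a b hab =>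
    le_iInf₂ fun u hu => hR_le _ _ ⟨hu.1, hu.2.trans (by gcongr)⟩
  have hε : ∀ k, ∃ ε, 0 < ε ∧ ε ≤ δ k ∧ r ≤ R ε + δ k / 8 := by
    intro k
    have h8 : 0 < δ k / 8 := ENNReal.div_pos (hδ k).ne' (by simp)
    obtain ⟨ε, hε, h⟩ : ∃ ε, 0 < ε ∧ r ≤ R ε + δ k / 8 := by
      by_cases hr0 : r = 0
      · exact ⟨1, one_pos, by simp [hr0]⟩
      · have : r - δ k / 8 < r := ENNReal.sub_lt_self hr_top hr0 h8.ne'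
        obtain ⟨⟨ε, hε⟩, h⟩ := lt_iSup_iff.1 this
        exact ⟨ε, hε, tsub_le_iff_right.1 h.le⟩
    exact ⟨min ε (δ k), lt_min hε (hδ k), min_le_right _ _,
      h.trans (by gcongr; exact hRanti (min_le_left _ _))⟩
  choose ε hε0 hεδ hεr using hε
  have hu : ∀ k, ∃ u ∈ S (ε k), N u ≤ r + δ k / 8 := by
    intro k
    have h8 : 0 < δ k / 8 := ENNReal.div_pos (hδ k).ne' (by simp)
    have hRt : R (ε k) ≠ ∞ := ne_top_of_le_ne_top hr_top (hR_r _ (hε0 k))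
    have : R (ε k) < R (ε k) + δ k / 8 := ENNReal.lt_add_right hRt h8.ne'
    obtain ⟨u, hu, hlt⟩ : ∃ u ∈ S (ε k), N u < R (ε k) + δ k / 8 := by
      rw [show R (ε k) = ⨅ u ∈ S (ε k), N u from rfl, iInf_lt_iff] at this
      obtain ⟨u, h⟩ := this
      obtain ⟨h1, h2⟩ := iInf_lt_iff.1 h
      exact ⟨u, h1, h2⟩
    exact ⟨u, hu, hlt.le.trans (by gcongr; exact hR_r _ (hε0 k))⟩
  choose u huS huN using hu
  refine ⟨u, fun k => (huS k).1, fun k w hw => (huS k).2.trans ?_, fun k l hkl => ?_⟩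
  · exact add_le_add (hm_le w hw) (hεδ k)
  -- By quasiconvexity the midpoint is a near-minimizer for the larger tolerance, so its `N` is at
  -- least `r - δ k / 8`, while both endpoints have `N` at most `r + δ k / 8`.
  · have hmid : (1 / 2 : ℝ) • (u k + u l) ∈ S (max (ε k) (ε l)) := by
      refine ⟨hC _ (huS k).1 _ (huS l).1, (hI _ (huS k).1 _ (huS l).1).trans (max_le ?_ ?_)⟩
      · exact (huS k).2.trans (by gcongr; exact le_max_left _ _)
      · exact (huS l).2.trans (by gcongr; exact le_max_right _ _)
    have hr_mid : r ≤ N ((1 / 2 : ℝ) • (u k + u l)) + δ k / 8 := by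
      rcases le_total (ε k) (ε l) with h | h
      · rw [max_eq_right h] at hmid
        exact (hεr l).trans (add_le_add (hR_le _ _ hmid) (by gcongr; exact hδa hkl))
      · rw [max_eq_left h] at hmid
        exact (hεr k).trans (add_le_add (hR_le _ _ hmid) le_rfl)
    have hl : N (u l) ≤ r + δ k / 8 := (huN l).trans (by gcongr; exact hδa hkl)
    -- The parallelogram law spends the error `δ k / 8` twice for each endpoint and four times for
    -- the midpoint, whence the eighths.
    have key : N (u k - u l) + 4 * r ≤ δ k + 4 * r := by
      calc N (u k - u l) + 4 * r
          ≤ N (u k - u l) + 4 * (N ((1 / 2 : ℝ) • (u k + u l)) + δ k / 8) := by gcongr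
        _ = (2 * N (u k) + 2 * N (u l)) + 4 * (δ k / 8) := by
            rw [← hN _ (huS k).1 _ (huS l).1]; ring
        _ ≤ (2 * (r + δ k / 8) + 2 * (r + δ k / 8)) + 4 * (δ k / 8) := by
            gcongr
            exact huN k
        _ = 8 * (δ k / 8) + 4 * r := by ring
        _ = δ k + 4 * r := by
            rw [ENNReal.mul_div_cancel (by simp) (by simp)]
    exact (ENNReal.add_le_add_iff_right (ENNReal.mul_ne_top (by simp) hr_top)).1 key

open Classical in
/-- The pointwise limit of a sequence of functions, `0` where there is none. -/
noncomputable def convLimit {α E : Type*} [TopologicalSpace E] [Zero E] (w : ℕ → α → E) (a : α) :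
    E :=
  if h : ∃ l, Filter.Tendsto (fun k => w k a) Filter.atTop (nhds l) then h.choose else 0

theorem convLimit_eq {α E : Type*} [TopologicalSpace E] [T2Space E] [Zero E] {w : ℕ → α → E}
    {a : α} {l : E} (h : Filter.Tendsto (fun k => w k a) Filter.atTop (nhds l)) :
    convLimit w a = l := by
  have h' : ∃ l, Filter.Tendsto (fun k => w k a) Filter.atTop (nhds l) := ⟨l, h⟩
  rw [convLimit, dif_pos h']
  exact tendsto_nhds_unique h'.choose_spec h

theorem convLimit_congr {α β E : Type*} [TopologicalSpace E] [T2Space E] [Zero E] {w : ℕ → α → E}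
    {w' : ℕ → β → E} {a : α} {b : β} (h : ∀ k, w k a = w' k b) :
    convLimit w a = convLimit w' b := by
  have : (fun k => w k a) = fun k => w' k b := funext h
  by_cases hl : ∃ l, Filter.Tendsto (fun k => w k a) Filter.atTop (nhds l)
  · obtain ⟨l, hl⟩ := hl
    rw [convLimit_eq hl, convLimit_eq (this ▸ hl)]
  · rw [convLimit, convLimit, dif_neg hl, dif_neg (this ▸ hl)]

theorem convLimit_mem {α E : Type*} [TopologicalSpace E] [Zero E] {w : ℕ → α → E}
    {a : α} {K : Set E} (hK : IsClosed K) (h0 : (0 : E) ∈ K) (h : ∀ k, w k a ∈ K) :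
    convLimit w a ∈ K := by
  unfold convLimit
  split_ifs with hl
  · exact hK.mem_of_tendsto hl.choose_spec (Filter.Eventually.of_forall h)
  · exact h0

/-- The convergence set is measurable; cutting off to it makes the sequence converge everywhere. The
σ-algebra is arbitrary, so the same limit is both jointly measurable and, at each fixed time,
measurable for the filtration. -/
theorem measurable_convLimit {α : Type*} {m : MeasurableSpace α} {n : ℕ} {w : ℕ → α → Vec n}
    (hw : ∀ k, Measurable (w k)) : Measurable (convLimit w) := by
  have hE : MeasurableSet
      {a | ∃ l, Filter.Tendsto (fun k => w k a) Filter.atTop (nhds l)} :=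
    measurableSet_exists_tendsto hw
  refine measurable_of_tendsto_metrizable (f := fun k =>
    {a | ∃ l, Filter.Tendsto (fun k => w k a) Filter.atTop (nhds l)}.indicator (w k))
    (fun k => (hw k).indicator hE) (tendsto_pi_nhds.2 fun a => ?_)
  by_cases ha : ∃ l, Filter.Tendsto (fun k => w k a) Filter.atTop (nhds l)
  · obtain ⟨l, hl⟩ := ha
    rw [convLimit_eq hl]
    refine hl.congr fun k => ?_
    rw [Set.indicator_of_mem]
    exact ⟨l, hl⟩
  · have : convLimit w a = 0 := by rw [convLimit, dif_neg ha]
    rw [this]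
    refine tendsto_const_nhds.congr fun k => ?_
    rw [Set.indicator_of_notMem]
    exact ha

end SwingControl

namespace SwingControl

/-! ### Controls: convex combination, gluing and limits -/

theorem lintegral_le_of_ae_tendsto {α : Type*} [MeasurableSpace α] {μ : Measure α}
    {q : ℕ → α → ℝ≥0∞} {q' : α → ℝ≥0∞} {c : ℝ≥0∞} (hq : ∀ k, Measurable (q k))
    (hlim : ∀ᵐ a ∂μ, Filter.Tendsto (fun k => q k a) Filter.atTop (nhds (q' a)))
    (hc : ∀ᶠ k in Filter.atTop, ∫⁻ a, q k a ∂μ ≤ c) : ∫⁻ a, q' a ∂μ ≤ c := by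
  calc ∫⁻ a, q' a ∂μ ≤ ∫⁻ a, Filter.liminf (fun k => q k a) Filter.atTop ∂μ :=
        lintegral_mono_ae (hlim.mono fun a ha => ha.liminf_eq.ge)
    _ ≤ Filter.liminf (fun k => ∫⁻ a, q k a ∂μ) Filter.atTop := lintegral_liminf_le hq
    _ ≤ c := Filter.liminf_le_of_frequently_le' hc.frequently

theorem eLpNorm_two_sq {α E : Type*} [MeasurableSpace α] {μ : Measure α} [NormedAddCommGroup E]
    (x : α → E) : eLpNorm x 2 μ ^ 2 = ∫⁻ a, ‖x a‖ₑ ^ 2 ∂μ := by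
  have := eLpNorm_nnreal_pow_eq_lintegral (f := x) (μ := μ) (p := 2) (by simp)
  simpa using this

theorem lintegral_enorm_sq_le {α E : Type*} [MeasurableSpace α] {μ : Measure α}
    [NormedAddCommGroup E] {x : α → E} (hx : AEStronglyMeasurable x μ) :
    (∫⁻ a, ‖x a‖ₑ ∂μ) ^ 2 ≤ (∫⁻ a, ‖x a‖ₑ ^ 2 ∂μ) * μ Set.univ := by
  have h := eLpNorm_le_eLpNorm_mul_rpow_measure_univ (p := 1) (q := 2) (by norm_num) hx
  rw [eLpNorm_one_eq_lintegral_enorm] at h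
  calc _ ≤ _ := pow_le_pow_left' h 2
    _ = _ := by
      rw [mul_pow, eLpNorm_two_sq, ← ENNReal.rpow_natCast, ← ENNReal.rpow_mul]
      norm_num

section

variable {Ω : Type*} {mΩ : MeasurableSpace Ω} {n : ℕ}

/-- The integral of `q` over the time interval `[τ,T]`, for each `ω`. -/
noncomputable def timeIntegral (T : ℝ≥0) (τ : Ω → ℝ≥0) (q : ℝ≥0 × Ω → ℝ≥0∞) (ω : Ω) : ℝ≥0∞ :=
  ∫⁻ s in Set.Icc (τ ω : ℝ) (T : ℝ), q (s.toNNReal, ω)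

/-- The product measure `ds × P` restricted to `τ ≤ s ≤ T`. -/
noncomputable def controlMeasure (P : Measure Ω) (T : ℝ≥0) (τ : Ω → ℝ≥0) : Measure (ℝ≥0 × Ω) :=
  ((volume.prod P).restrict {p : ℝ × Ω | (τ p.2 : ℝ) ≤ p.1 ∧ p.1 ≤ T}).map
    (fun p => (p.1.toNNReal, p.2))

theorem measurableSet_timeSet {T : ℝ≥0} {τ : Ω → ℝ≥0} (hτ : Measurable τ) :
    MeasurableSet {p : ℝ × Ω | (τ p.2 : ℝ) ≤ p.1 ∧ p.1 ≤ T} := by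
  rw [Set.ofPred_and]
  exact (measurableSet_le (by fun_prop) (by fun_prop)).inter
    (measurableSet_le (by fun_prop) (by fun_prop))

theorem timeIntegral_eq_lintegral_indicator (T : ℝ≥0) (τ : Ω → ℝ≥0) (q : ℝ≥0 × Ω → ℝ≥0∞)
    (ω : Ω) : timeIntegral T τ q ω =
      ∫⁻ s : ℝ, {p : ℝ × Ω | (τ p.2 : ℝ) ≤ p.1 ∧ p.1 ≤ T}.indicator
        (fun p => q (p.1.toNNReal, p.2)) (s, ω) := by
  rw [timeIntegral, ← lintegral_indicator measurableSet_Icc]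
  rfl

theorem measurable_timeIntegral {T : ℝ≥0} {τ : Ω → ℝ≥0} (hτ : Measurable τ)
    {q : ℝ≥0 × Ω → ℝ≥0∞} (hq : Measurable q) : Measurable (timeIntegral T τ q) := by
  simp only [funext (timeIntegral_eq_lintegral_indicator T τ q)]
  refine Measurable.lintegral_prod_left' (Measurable.indicator ?_ (measurableSet_timeSet hτ))
  fun_prop

theorem lintegral_controlMeasure {P : Measure Ω} [SFinite P] {T : ℝ≥0} {τ : Ω → ℝ≥0}
    (hτ : Measurable τ) {q : ℝ≥0 × Ω → ℝ≥0∞} (hq : Measurable q) :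
    ∫⁻ p, q p ∂(controlMeasure P T τ) = ∫⁻ ω, timeIntegral T τ q ω ∂P := by
  have hm : Measurable fun p : ℝ × Ω => q (p.1.toNNReal, p.2) := by fun_prop
  rw [controlMeasure, lintegral_map hq (by fun_prop),
    ← lintegral_indicator (measurableSet_timeSet hτ),
    lintegral_prod_symm' _ (hm.indicator (measurableSet_timeSet hτ))]
  simp only [timeIntegral_eq_lintegral_indicator]

/-- Admissible controls which are everywhere `K`-valued and jointly measurable. -/
structure IsControl (P : Measure Ω) (𝓕 : Filtration ℝ≥0 mΩ) (T : ℝ≥0) (Γ K : Set (Vec n))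
    (τ : Ω → ℝ≥0) (Y : Ω → Vec n) (v : ℝ≥0 × Ω → Vec n) : Prop where
  mem : ∀ p, v p ∈ K
  measurable : Measurable v
  adapted : ∀ s ≤ T, Measurable[𝓕 s] ({ω | τ ω ≤ s}.indicator fun ω => v (s, ω))
  integrableOn : ∀ᵐ ω ∂P,
    IntegrableOn (fun s : ℝ => v (s.toNNReal, ω)) (Set.Icc (τ ω : ℝ) (T : ℝ))
  constraint : ∀ᵐ ω ∂P,
    (Y ω + ∫ s in Set.Icc (τ ω : ℝ) (T : ℝ), v (s.toNNReal, ω)) ∈ Γ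

variable {P : Measure Ω} {𝓕 : Filtration ℝ≥0 mΩ} {T : ℝ≥0} {Γ K : Set (Vec n)}
  {τ : Ω → ℝ≥0} {Y : Ω → Vec n}

theorem IsControl.isAdmissible (hτ : Measurable τ) {v : ℝ≥0 × Ω → Vec n}
    (hv : IsControl P 𝓕 T Γ K τ Y v) :
    IsAdmissible P 𝓕 T Γ K τ Y (fun s ω => v (s, ω)) where
  mem ω s _ _ := hv.mem _
  measurable := hv.measurable.indicator
    ((measurableSet_le (by fun_prop) (by fun_prop)).inter
      (measurableSet_le (by fun_prop) (by fun_prop)))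
  adapted := hv.adapted
  integrableOn := hv.integrableOn
  constraint := hv.constraint

theorem toNNReal_mem_Icc {a b : ℝ≥0} {s : ℝ} (hs : s ∈ Set.Icc (a : ℝ) (b : ℝ)) :
    a ≤ s.toNNReal ∧ s.toNNReal ≤ b :=
  ⟨NNReal.le_toNNReal_of_coe_le hs.1, Real.toNNReal_le_iff_le_coe.2 hs.2⟩

/-- Extend by `0 ∈ K` outside `[τ, T]`; neither the constraint nor the payoff sees those times. -/
theorem IsAdmissible.exists_isControl (h0 : (0 : Vec n) ∈ K) {u : ℝ≥0 → Ω → Vec n}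
    (hu : IsAdmissible P 𝓕 T Γ K τ Y u) :
    ∃ v, IsControl P 𝓕 T Γ K τ Y v ∧ ∀ ω s, τ ω ≤ s → s ≤ T → v (s, ω) = u s ω := by
  set v : ℝ≥0 × Ω → Vec n :=
    {p : ℝ≥0 × Ω | τ p.2 ≤ p.1 ∧ p.1 ≤ T}.indicator (fun p => u p.1 p.2) with hv
  have hvu : ∀ ω s, τ ω ≤ s → s ≤ T → v (s, ω) = u s ω := by
    intro ω s h1 h2
    rw [hv, Set.indicator_of_mem (by exact ⟨h1, h2⟩)]
  have hcongr : ∀ ω, Set.EqOn (fun s : ℝ => u s.toNNReal ω) (fun s : ℝ => v (s.toNNReal, ω))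
      (Set.Icc (τ ω : ℝ) (T : ℝ)) := fun ω s hs =>
    (hvu _ _ (toNNReal_mem_Icc hs).1 (toNNReal_mem_Icc hs).2).symm
  refine ⟨v, ⟨fun p => ?_, hu.measurable, fun s hs => ?_, ?_, ?_⟩, hvu⟩
  · by_cases hp : τ p.2 ≤ p.1 ∧ p.1 ≤ T
    · exact (hvu p.2 p.1 hp.1 hp.2) ▸ hu.mem p.2 p.1 hp.1 hp.2
    · rw [hv, Set.indicator_of_notMem (by exact hp)]
      exact h0
  · have : ({ω | τ ω ≤ s}.indicator fun ω => v (s, ω)) = {ω | τ ω ≤ s}.indicator (u s) :=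
      Set.indicator_congr fun ω hω => hvu ω s hω hs
    rw [this]
    exact hu.adapted s hs
  · filter_upwards [hu.integrableOn] with ω hω
    exact hω.congr_fun (hcongr ω) measurableSet_Icc
  · filter_upwards [hu.constraint] with ω hω
    rwa [← setIntegral_congr_fun measurableSet_Icc (hcongr ω)]

theorem isControl_zero (h0 : (0 : Vec n) ∈ K) (hY : ∀ᵐ ω ∂P, Y ω ∈ Γ) :
    IsControl P 𝓕 T Γ K τ Y 0 where
  mem _ := h0
  measurable := measurable_const
  adapted s _ := by
    have : ({ω | τ ω ≤ s}.indicator fun ω => (0 : ℝ≥0 × Ω → Vec n) (s, ω)) = fun _ => 0 := by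
      funext ω; simp [Set.indicator]
    rw [this]
    exact measurable_const
  integrableOn := Filter.Eventually.of_forall fun ω => by simp
  constraint := hY.mono fun ω h => by simpa using h

theorem IsControl.midpoint (hK : Convex ℝ K) (hΓ : Convex ℝ Γ) {v w : ℝ≥0 × Ω → Vec n}
    (hv : IsControl P 𝓕 T Γ K τ Y v) (hw : IsControl P 𝓕 T Γ K τ Y w) :
    IsControl P 𝓕 T Γ K τ Y ((1 / 2 : ℝ) • (v + w)) where
  mem p := by
    have := hK (hv.mem p) (hw.mem p) (a := 1 / 2) (b := 1 / 2) (by norm_num) (by norm_num)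
      (by norm_num)
    simpa [smul_add] using this
  measurable := (hv.measurable.add hw.measurable).const_smul _
  adapted s hs := by
    have : ({ω | τ ω ≤ s}.indicator fun ω => ((1 / 2 : ℝ) • (v + w)) (s, ω)) =
        (1 / 2 : ℝ) • (({ω | τ ω ≤ s}.indicator fun ω => v (s, ω)) +
          {ω | τ ω ≤ s}.indicator fun ω => w (s, ω)) := by
      funext ω
      by_cases h : ω ∈ {ω | τ ω ≤ s} <;> simp [h]
    rw [this]
    exact ((hv.adapted s hs).add (hw.adapted s hs)).const_smul _
  integrableOn := by
    filter_upwards [hv.integrableOn, hw.integrableOn] with ω h1 h2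
    exact (h1.add h2).smul (1 / 2 : ℝ)
  constraint := by
    filter_upwards [hv.integrableOn, hw.integrableOn, hv.constraint, hw.constraint]
      with ω h1 h2 h3 h4
    have := hΓ h3 h4 (a := 1 / 2) (b := 1 / 2) (by norm_num) (by norm_num) (by norm_num)
    convert this using 1
    simp only [Pi.smul_apply, Pi.add_apply]
    rw [integral_smul, integral_add h1 h2]
    module

-- Adaptedness is only required on `{τ ≤ s}`, and `A ∈ 𝓕_τ` means precisely that `A` meets each of
-- these sets in an element of `𝓕 s`.
open Classical in
theorem IsControl.piecewise (hτ : IsStoppingTime 𝓕 (fun ω => (τ ω : WithTop ℝ≥0)))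
    {v w : ℝ≥0 × Ω → Vec n} (hv : IsControl P 𝓕 T Γ K τ Y v) (hw : IsControl P 𝓕 T Γ K τ Y w)
    {A : Set Ω} (hA : MeasurableSet[hτ.measurableSpace] A) :
    IsControl P 𝓕 T Γ K τ Y (fun p => if p.2 ∈ A then v p else w p) where
  mem p := by split_ifs <;> [exact hv.mem p; exact hw.mem p]
  measurable := Measurable.ite (measurable_snd (hτ.measurableSpace_le A hA))
    hv.measurable hw.measurable
  adapted s hs := by
    have hAs : ∀ B, MeasurableSet[hτ.measurableSpace] B →
        MeasurableSet[𝓕 s] (B ∩ {ω | τ ω ≤ s}) := fun B hB => by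
      have := ((hτ.measurableSet B).1 hB).2 s
      simpa only [WithTop.coe_le_coe] using this
    have : ({ω | τ ω ≤ s}.indicator fun ω => if ω ∈ A then v (s, ω) else w (s, ω)) =
        (A ∩ {ω | τ ω ≤ s}).indicator ({ω | τ ω ≤ s}.indicator fun ω => v (s, ω)) +
        (Aᶜ ∩ {ω | τ ω ≤ s}).indicator ({ω | τ ω ≤ s}.indicator fun ω => w (s, ω)) := by
      funext ω
      by_cases h : τ ω ≤ s <;> by_cases h' : ω ∈ A <;> simp [Set.indicator, h, h']
    rw [this]
    exact ((hv.adapted s hs).indicator (hAs A hA)).add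
      ((hw.adapted s hs).indicator (hAs _ hA.compl))
  integrableOn := by
    filter_upwards [hv.integrableOn, hw.integrableOn] with ω h1 h2
    by_cases h : ω ∈ A <;> simpa [h]
  constraint := by
    filter_upwards [hv.constraint, hw.constraint] with ω h1 h2
    by_cases h : ω ∈ A <;> simpa [h]

/-- The geometric rate makes the squared L² distances to the limit summable, so for almost every `ω`
they tend to `0` along the path without passing to a subsequence. Cauchy–Schwarz on the bounded
interval turns this into L¹ convergence in time, and closedness of `Γ` finishes. -/
theorem IsControl.convLimit [SFinite P] (hτ : Measurable τ) (hK : IsClosed K)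
    (h0 : (0 : Vec n) ∈ K) (hΓ : IsClosed Γ) {w : ℕ → ℝ≥0 × Ω → Vec n}
    (hw : ∀ k, IsControl P 𝓕 T Γ K τ Y (w k))
    (hδ : ∀ k l, k ≤ l →
      ∫⁻ p, ‖w k p - w l p‖ₑ ^ 2 ∂(controlMeasure P T τ) ≤ (2⁻¹ ^ (k + 1)) ^ 2) :
    IsControl P 𝓕 T Γ K τ Y (convLimit w) ∧ ∀ᵐ p ∂(controlMeasure P T τ),
      Filter.Tendsto (fun k => w k p) Filter.atTop (nhds (convLimit w p)) := by
  set μ := controlMeasure P T τ with hμ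
  have hmeas : Measurable (SwingControl.convLimit w) :=
    measurable_convLimit fun k => (hw k).measurable
  have hlim : ∀ᵐ p ∂μ,
      Filter.Tendsto (fun k => w k p) Filter.atTop (nhds (SwingControl.convLimit w p)) := by
    have hB : ∑' i : ℕ, (2⁻¹ : ℝ≥0∞) ^ i ≠ ∞ := by
      rw [ENNReal.tsum_geometric]; simp
    -- The Cauchy criterion used below asks for a strict bound by `2⁻¹ ^ N`; the exponent `k + 1` in
    -- the rate leaves this room.
    have hlt : ∀ N : ℕ, (2⁻¹ : ℝ≥0∞) ^ (N + 1) < 2⁻¹ ^ N := by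
      intro N
      have h2 : (2⁻¹ : ℝ≥0∞) < 1 := by simp
      calc (2⁻¹ : ℝ≥0∞) ^ (N + 1) = 2⁻¹ ^ N * 2⁻¹ := pow_succ _ _
        _ < 2⁻¹ ^ N * 1 := by
          refine ENNReal.mul_lt_mul_right (pow_ne_zero _ (by simp)) (ENNReal.pow_ne_top (by simp))
            h2
        _ = _ := mul_one _
    have hle : ∀ N k l, N ≤ k → k ≤ l → eLpNorm (w k - w l) 2 μ ≤ 2⁻¹ ^ (N + 1) := by
      intro N k l hN hkl
      have h1 : eLpNorm (w k - w l) 2 μ ^ 2 ≤ (2⁻¹ ^ (k + 1)) ^ 2 := by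
        rw [eLpNorm_two_sq]
        exact hδ k l hkl
      refine ((ENNReal.pow_le_pow_left_iff two_ne_zero).1 h1).trans ?_
      exact pow_le_pow_right_of_le_one' (by simp) (by omega)
    have := Lp.ae_tendsto_of_cauchy_eLpNorm (μ := μ) (f := w) (p := 2)
      (fun k => (hw k).measurable.aestronglyMeasurable) (by norm_num) hB (by
        intro N k l hk hl
        refine lt_of_le_of_lt ?_ (hlt N)
        rcases le_total k l with h | h
        · exact hle N k l hk h
        · rw [eLpNorm_sub_comm]
          exact hle N l k hl h)
    filter_upwards [this] with p ⟨l, hl⟩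
    rwa [convLimit_eq hl]
  -- Fatou's lemma as `l → ∞` in the Cauchy estimate.
  have hdist : ∀ k, ∫⁻ p, ‖w k p - SwingControl.convLimit w p‖ₑ ^ 2 ∂μ ≤ (2⁻¹ ^ (k + 1)) ^ 2 := by
    intro k
    refine lintegral_le_of_ae_tendsto (q := fun l p => ‖w k p - w l p‖ₑ ^ 2)
      (fun l => (((hw k).measurable.sub (hw l).measurable).enorm).pow_const 2) ?_
      (Filter.eventually_atTop.2 ⟨k, fun l hl => hδ k l hl⟩)
    filter_upwards [hlim] with p hp
    exact ((ENNReal.continuous_pow 2).tendsto _).comp (tendsto_const_nhds.sub hp).enorm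
  have hqm : ∀ k, Measurable fun p => ‖w k p - SwingControl.convLimit w p‖ₑ ^ 2 := fun k =>
    (((hw k).measurable.sub hmeas).enorm).pow_const 2
  have hsum : ∀ᵐ ω ∂P, ∑' k, timeIntegral T τ
      (fun p => ‖w k p - SwingControl.convLimit w p‖ₑ ^ 2) ω < ∞ := by
    refine ae_lt_top (Measurable.tsum fun k => measurable_timeIntegral hτ (hqm k)) ?_
    rw [lintegral_tsum fun k => (measurable_timeIntegral hτ (hqm k)).aemeasurable]
    have : ∑' i : ℕ, (2⁻¹ : ℝ≥0∞) ^ i ≠ ∞ := by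
      rw [ENNReal.tsum_geometric]; simp
    refine ne_top_of_le_ne_top this (ENNReal.tsum_le_tsum fun k => ?_)
    rw [← lintegral_controlMeasure hτ (hqm k)]
    refine (hdist k).trans ?_
    rw [← pow_mul]
    exact pow_le_pow_right_of_le_one' (by simp) (by omega)
  have hL1 : ∀ᵐ ω ∂P, Filter.Tendsto (fun k => ∫⁻ s in Set.Icc (τ ω : ℝ) (T : ℝ),
      ‖w k (s.toNNReal, ω) - SwingControl.convLimit w (s.toNNReal, ω)‖ₑ) Filter.atTop
      (nhds 0) := by
    filter_upwards [hsum] with ω hω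
    have h1 := ENNReal.tendsto_atTop_zero_of_tsum_ne_top hω.ne
    have h2 : Filter.Tendsto (fun k => timeIntegral T τ
        (fun p => ‖w k p - SwingControl.convLimit w p‖ₑ ^ 2) ω *
          (volume.restrict (Set.Icc (τ ω : ℝ) (T : ℝ))) Set.univ) Filter.atTop (nhds 0) := by
      have := ENNReal.Tendsto.mul_const (b := (volume.restrict (Set.Icc (τ ω : ℝ) (T : ℝ)))
        Set.univ) h1 (Or.inr (measure_ne_top _ _))
      simpa using this
    have h3 : Filter.Tendsto (fun k => (∫⁻ s in Set.Icc (τ ω : ℝ) (T : ℝ),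
        ‖w k (s.toNNReal, ω) - SwingControl.convLimit w (s.toNNReal, ω)‖ₑ) ^ 2) Filter.atTop
        (nhds 0) := by
      refine tendsto_of_tendsto_of_tendsto_of_le_of_le tendsto_const_nhds h2
        (fun k => zero_le) fun k => lintegral_enorm_sq_le (Measurable.aestronglyMeasurable ?_)
      have := (hw k).measurable
      fun_prop
    have h4 := (ENNReal.continuous_rpow_const (y := (1 / 2 : ℝ))).tendsto 0 |>.comp h3
    simp only [Function.comp_def, ← ENNReal.rpow_natCast, ← ENNReal.rpow_mul] at h4
    simpa using h4
  have hint : ∀ᵐ ω ∂P, IntegrableOn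
      (fun s : ℝ => SwingControl.convLimit w (s.toNNReal, ω)) (Set.Icc (τ ω : ℝ) (T : ℝ)) := by
    filter_upwards [hL1, ae_all_iff.2 fun k => (hw k).integrableOn] with ω h1 h2
    obtain ⟨k, hk⟩ := (h1.eventually (gt_mem_nhds (zero_lt_one' ℝ≥0∞))).exists
    have h3 : IntegrableOn (fun s : ℝ => w k (s.toNNReal, ω) -
        SwingControl.convLimit w (s.toNNReal, ω)) (Set.Icc (τ ω : ℝ) (T : ℝ)) := by
      refine ⟨Measurable.aestronglyMeasurable ?_, hk.trans ENNReal.one_lt_top⟩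
      have := (hw k).measurable
      fun_prop
    exact ((h2 k).sub h3).congr_fun (fun s _ => by simp) measurableSet_Icc
  refine ⟨⟨fun p => convLimit_mem hK h0 fun k => (hw k).mem p, hmeas, fun s hs => ?_, hint, ?_⟩,
    hlim⟩
  -- At fixed `s` the truncated limit is the limit of the truncated slices, each `𝓕 s`-measurable;
  -- where `τ > s` these are constantly `0`. An almost everywhere defined limit would not give this
  -- for every `s`.
  · have : ({ω | τ ω ≤ s}.indicator fun ω => SwingControl.convLimit w (s, ω)) =
        SwingControl.convLimit fun k => {ω | τ ω ≤ s}.indicator fun ω => w k (s, ω) := by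
      funext ω
      by_cases h : ω ∈ {ω | τ ω ≤ s}
      · rw [Set.indicator_of_mem h]
        exact convLimit_congr fun k =>
          (Set.indicator_of_mem h fun ω => w k (s, ω)).symm
      · rw [Set.indicator_of_notMem h]
        refine (convLimit_eq ?_).symm
        simp only [Set.indicator_of_notMem h]
        exact tendsto_const_nhds
    rw [this]
    exact measurable_convLimit fun k => (hw k).adapted s hs
  · filter_upwards [hL1, hint, ae_all_iff.2 fun k => (hw k).integrableOn,
      ae_all_iff.2 fun k => (hw k).constraint] with ω h1 h2 h3 h4
    have h5 := tendsto_integral_of_L1 _ h2.aestronglyMeasurable (Filter.Eventually.of_forall h3) h1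
    exact hΓ.mem_of_tendsto (tendsto_const_nhds.add h5) (Filter.Eventually.of_forall h4)

end

end SwingControl

namespace SwingControl

/-! ### Minimizing the expected loss for a concave coercive payoff -/

/-- Running payoffs `φ(x,u)` which are concave and coercive in `u ∈ K`. -/
structure IsCoercivePayoff {n : ℕ} (K : Set (Vec n)) (φ : Vec n → Vec n → ℝ) (c C : ℝ) :
    Prop where
  continuous : Continuous fun p : Vec n × Vec n => φ p.1 p.2
  concave : ∀ x, ConcaveOn ℝ K (φ x)
  zero_mem : (0 : Vec n) ∈ K
  zero : ∀ x, φ x 0 = 0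
  pos : 0 < c
  coercive : ∀ x, ∀ u ∈ K, c * ‖u‖ ^ 2 + φ x u ≤ C * (1 + ‖x‖ ^ 2)

section

variable {Ω : Type*} {m mΩ : MeasurableSpace Ω} {n : ℕ}

/-- The nonnegative loss `C (1 + |Z|²) - φ(Z,v)`. -/
noncomputable def loss (φ : Vec n → Vec n → ℝ) (C : ℝ) (Z v : ℝ≥0 × Ω → Vec n)
    (p : ℝ≥0 × Ω) : ℝ≥0∞ :=
  ENNReal.ofReal (C * (1 + ‖Z p‖ ^ 2) - φ (Z p) (v p))

/-- The upper bound `C (1 + |Z|²)` for the running payoff. -/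
noncomputable def payoffBound (C : ℝ) (Z : ℝ≥0 × Ω → Vec n) (p : ℝ≥0 × Ω) : ℝ≥0∞ :=
  ENNReal.ofReal (C * (1 + ‖Z p‖ ^ 2))

variable {K : Set (Vec n)} {φ : Vec n → Vec n → ℝ} {c C : ℝ} {Z v : ℝ≥0 × Ω → Vec n}

theorem measurable_payoffBound (hZ : Measurable Z) : Measurable (payoffBound C Z) := by
  unfold payoffBound
  fun_prop

theorem IsCoercivePayoff.measurable_comp (hφ : IsCoercivePayoff K φ c C) (hZ : Measurable Z)
    (hv : Measurable v) : Measurable fun p => φ (Z p) (v p) :=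
  hφ.continuous.measurable.comp (hZ.prodMk hv)

theorem IsCoercivePayoff.measurable_loss (hφ : IsCoercivePayoff K φ c C) (hZ : Measurable Z)
    (hv : Measurable v) : Measurable (loss φ C Z v) := by
  have h : Measurable fun p => C * (1 + ‖Z p‖ ^ 2) := by fun_prop
  exact (h.sub (hφ.measurable_comp hZ hv)).ennreal_ofReal

variable {T : ℝ≥0} {τ : Ω → ℝ≥0}

/-- Pointwise `φ` is the bound minus the loss, both nonnegative. Only the bound needs a finite time
integral. -/
theorem IsCoercivePayoff.payoff_eq_sub (hφ : IsCoercivePayoff K φ c C) (hZ : Measurable Z)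
    (hv : Measurable v) (hvK : ∀ p, v p ∈ K) {ω : Ω}
    (hD : timeIntegral T τ (payoffBound C Z) ω ≠ ∞) :
    payoff (fun x u _ => φ x u) (fun s ω => Z (s, ω)) T τ (fun s ω => v (s, ω)) ω =
      ((timeIntegral T τ (payoffBound C Z) ω : ℝ≥0∞) : EReal) -
        ((timeIntegral T τ (loss φ C Z v) ω : ℝ≥0∞) : EReal) := by
  have h1 : Measurable fun s : ℝ => φ (Z (s.toNNReal, ω)) (v (s.toNNReal, ω)) :=
    (hφ.measurable_comp hZ hv).comp (by fun_prop : Measurable fun s : ℝ => (s.toNNReal, ω))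
  have h2 : Measurable fun s : ℝ => payoffBound C Z (s.toNNReal, ω) :=
    (measurable_payoffBound hZ).comp (by fun_prop)
  have hc : ∀ p, φ (Z p) (v p) ≤ C * (1 + ‖Z p‖ ^ 2) := fun p => by
    have := hφ.coercive (Z p) (v p) (hvK p)
    have := mul_nonneg hφ.pos.le (sq_nonneg ‖v p‖)
    linarith
  -- Coercivity at `u = 0`, where `φ` vanishes, gives the sign of the bound.
  have hb : ∀ p, 0 ≤ C * (1 + ‖Z p‖ ^ 2) := fun p => by
    have := hφ.coercive (Z p) 0 hφ.zero_mem
    simpa [hφ.zero] using this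
  refine extIntegral_eq_sub ?_ h2.aemeasurable (Filter.Eventually.of_forall fun s => ?_)
    (Filter.Eventually.of_forall fun s => ?_) hD
  · simp only [EReal.real_coe_toENNReal]
    exact h1.ennreal_ofReal.aemeasurable
  · simp only [← EReal.coe_neg, EReal.real_coe_toENNReal, loss, payoffBound]
    generalize (s.toNNReal, ω) = p
    have h3 := hc p
    have h4 := hb p
    rcases le_total 0 (φ (Z p) (v p)) with h | h
    · rw [ENNReal.ofReal_of_nonpos (by linarith : -φ (Z p) (v p) ≤ 0), add_zero,
        ← ENNReal.ofReal_add h (by linarith)]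
      congr 1; ring
    · rw [ENNReal.ofReal_of_nonpos h, zero_add, ← ENNReal.ofReal_add h4 (by linarith)]
      congr 1
  · simp only [EReal.real_coe_toENNReal, payoffBound]
    exact ENNReal.ofReal_le_ofReal (hc _)

variable {P : Measure Ω}

/-- The first term does not depend on the control, so comparing payoffs reduces to comparing losses.
-/
theorem IsCoercivePayoff.payoff_decomposition (hφ : IsCoercivePayoff K φ c C) (hZ : Measurable Z)
    (hτ : Measurable τ) (hv : Measurable v) (hvK : ∀ p, v p ∈ K)
    (hD : ∫⁻ ω, timeIntegral T τ (payoffBound C Z) ω ∂P ≠ ∞) :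
    (∀ᵐ ω ∂P, extCondExp m P
      (payoff (fun x u _ => φ x u) (fun s ω => Z (s, ω)) T τ (fun s ω => v (s, ω))) ω =
        ((condLExp m P (timeIntegral T τ (payoffBound C Z)) ω : ℝ≥0∞) : EReal) -
          ((condLExp m P (timeIntegral T τ (loss φ C Z v)) ω : ℝ≥0∞) : EReal)) ∧
    extIntegral P
      (payoff (fun x u _ => φ x u) (fun s ω => Z (s, ω)) T τ (fun s ω => v (s, ω))) =
        ((∫⁻ ω, timeIntegral T τ (payoffBound C Z) ω ∂P : ℝ≥0∞) : EReal) -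
          ((∫⁻ ω, timeIntegral T τ (loss φ C Z v) ω ∂P : ℝ≥0∞) : EReal) := by
  have hDm := measurable_timeIntegral (T := T) hτ (measurable_payoffBound (C := C) hZ)
  have hHm := measurable_timeIntegral (T := T) hτ (hφ.measurable_loss hZ hv)
  have hfin : ∀ᵐ ω ∂P, timeIntegral T τ (payoffBound C Z) ω ≠ ∞ :=
    (ae_lt_top hDm hD).mono fun ω h => h.ne
  have heq := hfin.mono fun ω h => hφ.payoff_eq_sub hZ hv hvK h
  -- The positive part of the payoff is almost surely the truncated difference of two measurable
  -- time integrals.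
  have hm : AEMeasurable (fun ω =>
      (payoff (fun x u _ => φ x u) (fun s ω => Z (s, ω)) T τ
        (fun s ω => v (s, ω)) ω).toENNReal) P := by
    refine (hDm.sub hHm).aemeasurable.congr ?_
    filter_upwards [heq] with ω h
    rw [h, toENNReal_coe_sub]
    rfl
  have he : ∀ᵐ ω ∂P, (payoff (fun x u _ => φ x u) (fun s ω => Z (s, ω)) T τ
        (fun s ω => v (s, ω)) ω).toENNReal + timeIntegral T τ (loss φ C Z v) ω =
      timeIntegral T τ (payoffBound C Z) ω + (-payoff (fun x u _ => φ x u)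
        (fun s ω => Z (s, ω)) T τ (fun s ω => v (s, ω)) ω).toENNReal := by
    filter_upwards [heq, hfin] with ω h h'
    rw [h, toENNReal_coe_sub_add h']
  have hle : ∀ᵐ ω ∂P, (payoff (fun x u _ => φ x u) (fun s ω => Z (s, ω)) T τ
        (fun s ω => v (s, ω)) ω).toENNReal ≤ timeIntegral T τ (payoffBound C Z) ω := by
    filter_upwards [heq] with ω h
    rw [h, toENNReal_coe_sub]
    exact tsub_le_self
  exact ⟨extCondExp_ae_eq_sub m hm hDm.aemeasurable he hle hD,
    extIntegral_eq_sub hm hDm.aemeasurable he hle hD⟩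

variable {𝓕 : Filtration ℝ≥0 mΩ} {Γ : Set (Vec n)} {Y : Ω → Vec n}

/-- The expected loss attains its minimum on the set of controls. -/
theorem IsCoercivePayoff.exists_isMinOn [SFinite P] (hφ : IsCoercivePayoff K φ c C)
    (hZ : Measurable Z) (hτ : Measurable τ) (hKc : IsClosed K) (hK : Convex ℝ K)
    (hΓc : IsClosed Γ) (hΓ : Convex ℝ Γ) (hY : ∀ᵐ ω ∂P, Y ω ∈ Γ)
    (hD : ∫⁻ ω, timeIntegral T τ (payoffBound C Z) ω ∂P ≠ ∞) :
    ∃ v, IsControl P 𝓕 T Γ K τ Y v ∧ ∫⁻ ω, timeIntegral T τ (loss φ C Z v) ω ∂P ≠ ∞ ∧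
      ∀ w, IsControl P 𝓕 T Γ K τ Y w →
        ∫⁻ ω, timeIntegral T τ (loss φ C Z v) ω ∂P ≤
          ∫⁻ ω, timeIntegral T τ (loss φ C Z w) ω ∂P := by
  set μ := controlMeasure P T τ with hμ
  set I : (ℝ≥0 × Ω → Vec n) → ℝ≥0∞ := fun v => ∫⁻ p, loss φ C Z v p ∂μ with hI
  have hI_eq : ∀ v, Measurable v → I v = ∫⁻ ω, timeIntegral T τ (loss φ C Z v) ω ∂P :=
    fun v hv => lintegral_controlMeasure hτ (hφ.measurable_loss hZ hv)
  have hz : IsControl P 𝓕 T Γ K τ Y 0 := isControl_zero hφ.zero_mem hY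
  have hloss0 : loss φ C Z 0 = payoffBound C Z := by
    funext p
    simp [loss, payoffBound, hφ.zero]
  have hI0 : I 0 ≠ ∞ := by
    rw [hI_eq 0 hz.measurable, hloss0]
    exact hD
  have hle : ∀ p u, u ∈ K → φ (Z p) u ≤ C * (1 + ‖Z p‖ ^ 2) := fun p u hu => by
    have := hφ.coercive (Z p) u hu
    have := mul_nonneg hφ.pos.le (sq_nonneg ‖u‖)
    linarith
  have henorm : ∀ x : Vec n, ‖x‖ₑ ^ 2 = ENNReal.ofReal (‖x‖ ^ 2) := fun x => by
    rw [ENNReal.ofReal_pow (norm_nonneg x), ofReal_norm]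
  have htwo : ∀ x : ℝ, 2 * ENNReal.ofReal x = ENNReal.ofReal (2 * x) := fun x => by
    rw [ENNReal.ofReal_mul (by norm_num)]; simp
  have hfour : ∀ x : ℝ, 4 * ENNReal.ofReal x = ENNReal.ofReal (4 * x) := fun x => by
    rw [ENNReal.ofReal_mul (by norm_num)]; simp
  -- Coercivity says that the loss is at least `c‖v‖²`, hence `A = c⁻¹`. The tolerance is squared
  -- because `N` is the square of the L² norm.
  obtain ⟨w, hwC, hwI, hwN⟩ := exists_minimizing_cauchy
    (C := {v | IsControl P 𝓕 T Γ K τ Y v}) (I := I)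
    (N := fun v => ∫⁻ p, ‖v p‖ₑ ^ 2 ∂μ) (A := ENNReal.ofReal c⁻¹) (u₀ := 0)
    (δ := fun k => (2⁻¹ ^ (k + 1)) ^ 2)
    (fun u hu v hv => hu.midpoint hK hΓ hv)
    (by
      intro u hu v hv
      have hmid : 2 * I ((1 / 2 : ℝ) • (u + v)) ≤ I u + I v := by
        simp only [hI]
        rw [← lintegral_add_left (hφ.measurable_loss hZ hu.measurable),
          ← lintegral_const_mul _
            (hφ.measurable_loss hZ (hu.midpoint hK hΓ hv).measurable)]
        refine lintegral_mono fun p => ?_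
        have hcc : (1 / 2 : ℝ) • φ (Z p) (u p) + (1 / 2 : ℝ) • φ (Z p) (v p) ≤
            φ (Z p) ((1 / 2 : ℝ) • u p + (1 / 2 : ℝ) • v p) :=
          (hφ.concave (Z p)).2 (hu.mem p) (hv.mem p) (by norm_num) (by norm_num) (by norm_num)
        have e : (1 / 2 : ℝ) • u p + (1 / 2 : ℝ) • v p = ((1 / 2 : ℝ) • (u + v)) p := by
          simp [smul_add]
        rw [e, smul_eq_mul, smul_eq_mul] at hcc
        have h1 := hle p (u p) (hu.mem p)
        have h2 := hle p (v p) (hv.mem p)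
        simp only [loss]
        rw [← ENNReal.ofReal_add (by linarith) (by linarith), htwo]
        exact ENNReal.ofReal_le_ofReal (by linarith)
      have h2 : 2 * I ((1 / 2 : ℝ) • (u + v)) ≤ 2 * max (I u) (I v) := by
        refine hmid.trans ?_
        rw [two_mul]
        exact add_le_add (le_max_left _ _) (le_max_right _ _)
      exact (ENNReal.mul_le_mul_iff_right two_ne_zero (by simp)).1 h2)
    (by
      intro u hu v hv
      have hu' := hu.measurable
      have hv' := hv.measurable
      rw [← lintegral_const_mul _ (by fun_prop), ← lintegral_const_mul _ (by fun_prop),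
        ← lintegral_const_mul _ (by fun_prop), ← lintegral_add_left (by fun_prop),
        ← lintegral_add_left (by fun_prop)]
      refine lintegral_congr fun p => ?_
      have hpar := parallelogram_law_with_norm ℝ (u p) (v p)
      simp only [henorm, Pi.sub_apply, Pi.smul_apply, Pi.add_apply]
      rw [htwo, htwo, hfour, ← ENNReal.ofReal_add (by positivity) (by positivity),
        ← ENNReal.ofReal_add (by positivity) (by positivity), norm_smul, Real.norm_eq_abs,
        abs_of_pos (by norm_num : (0 : ℝ) < 1 / 2)]
      congr 1
      linarith)
    ENNReal.ofReal_ne_top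
    (by
      intro u hu
      simp only [hI]
      rw [← lintegral_const_mul _ (hφ.measurable_loss hZ hu.measurable)]
      refine lintegral_mono fun p => ?_
      have h1 := hφ.coercive (Z p) (u p) (hu.mem p)
      simp only [henorm, loss]
      rw [← ENNReal.ofReal_mul (inv_nonneg.2 hφ.pos.le)]
      refine ENNReal.ofReal_le_ofReal ?_
      rw [le_inv_mul_iff₀ hφ.pos]
      linarith)
    hz hI0
    (fun k => pos_iff_ne_zero.2 (pow_ne_zero _ (pow_ne_zero _ (by simp))))
    (fun k l hkl => by
      dsimp only
      gcongr ?_ ^ 2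
      exact pow_le_pow_right_of_le_one' (by simp) (by omega))
  obtain ⟨hlimC, hlim⟩ := IsControl.convLimit hτ hKc hφ.zero_mem hΓc hwC hwN
  have hmin : ∀ v, IsControl P 𝓕 T Γ K τ Y v → I (convLimit w) ≤ I v := by
    intro v hv
    -- Continuity of `φ` makes the losses converge almost everywhere; by Fatou's lemma the limit
    -- inherits the bound `I v + ε` that holds for all large `k`.
    refine ENNReal.le_of_forall_pos_le_add fun ε hε _ => ?_
    refine lintegral_le_of_ae_tendsto (q := fun k => loss φ C Z (w k))
      (fun k => hφ.measurable_loss hZ (hwC k).measurable) ?_ ?_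
    · filter_upwards [hlim] with p hp
      refine (ENNReal.continuous_ofReal.tendsto _).comp (tendsto_const_nhds.sub ?_)
      exact (hφ.continuous.tendsto (Z p, convLimit w p)).comp (tendsto_const_nhds.prodMk_nhds hp)
    · have h1 : Filter.Tendsto (fun k : ℕ => ((2⁻¹ : ℝ≥0∞) ^ (k + 1)) ^ 2) Filter.atTop
          (nhds 0) := by
        have h2 := ((ENNReal.tendsto_pow_atTop_nhds_zero_of_lt_one
          (show (2⁻¹ : ℝ≥0∞) < 1 by simp)).comp (Filter.tendsto_add_atTop_nat 1))
        have h3 := ((ENNReal.continuous_pow 2).tendsto 0).comp h2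
        simpa [Function.comp_def] using h3
      filter_upwards [h1.eventually (gt_mem_nhds (show (0 : ℝ≥0∞) < ε by exact_mod_cast hε))]
        with k hk
      exact (hwI k v hv).trans (by gcongr)
  refine ⟨convLimit w, hlimC, ?_, fun v hv => ?_⟩
  · rw [← hI_eq _ hlimC.measurable]
    exact ne_top_of_le_ne_top hI0 (hmin 0 hz)
  · rw [← hI_eq _ hlimC.measurable, ← hI_eq _ hv.measurable]
    exact hmin v hv

/-- A control minimizing the expected loss minimizes the conditional expected loss. -/
theorem condLExp_loss_le [IsFiniteMeasure P]
    (hτ : IsStoppingTime 𝓕 (fun ω => (τ ω : WithTop ℝ≥0)))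
    (hv : IsControl P 𝓕 T Γ K τ Y v)
    (hfin : ∫⁻ ω, timeIntegral T τ (loss φ C Z v) ω ∂P ≠ ∞)
    (hmin : ∀ w, IsControl P 𝓕 T Γ K τ Y w →
        ∫⁻ ω, timeIntegral T τ (loss φ C Z v) ω ∂P ≤
          ∫⁻ ω, timeIntegral T τ (loss φ C Z w) ω ∂P)
    {w : ℝ≥0 × Ω → Vec n} (hw : IsControl P 𝓕 T Γ K τ Y w) :
    condLExp hτ.measurableSpace P (timeIntegral T τ (loss φ C Z v)) ≤ᵐ[P]
      condLExp hτ.measurableSpace P (timeIntegral T τ (loss φ C Z w)) := by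
  classical
  refine condLExp_le_condLExp hτ.measurableSpace_le fun A hA => ?_
  have hA' := hτ.measurableSpace_le A hA
  -- The competitor is `w` on `A` and `v` off `A`; the finite contribution of `v` on `Aᶜ` then
  -- cancels.
  have h := hmin _ (hw.piecewise hτ hv hA)
  rw [← lintegral_add_compl _ hA', ← lintegral_add_compl (fun ω => timeIntegral T τ
    (loss φ C Z fun p => if p.2 ∈ A then w p else v p) ω) hA'] at h
  have h1 : ∫⁻ ω in A, timeIntegral T τ (loss φ C Z fun p => if p.2 ∈ A then w p else v p) ω ∂P =
      ∫⁻ ω in A, timeIntegral T τ (loss φ C Z w) ω ∂P :=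
    setLIntegral_congr_fun hA' fun ω hω => by simp [timeIntegral, loss, hω]
  have h2 : ∫⁻ ω in Aᶜ, timeIntegral T τ
      (loss φ C Z fun p => if p.2 ∈ A then w p else v p) ω ∂P =
      ∫⁻ ω in Aᶜ, timeIntegral T τ (loss φ C Z v) ω ∂P :=
    setLIntegral_congr_fun hA'.compl fun ω hω => by
      have : ω ∉ A := hω
      simp [timeIntegral, loss, this]
  rw [h1, h2] at h
  refine (ENNReal.add_le_add_iff_right ?_).1 h
  exact ne_top_of_le_ne_top hfin (setLIntegral_le_lintegral _ _)

end

end SwingControl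

namespace SwingControl

/-! ### Coercivity of the linear and quadratic payoffs -/

section Payoffs

variable {n : ℕ}

theorem dotProduct_ofLp_eq_inner (x u : Vec n) : u.ofLp ⬝ᵥ x.ofLp = inner ℝ x u := by
  rw [EuclideanSpace.inner_eq_star_dotProduct]
  simp

theorem continuous_ofLp_dotProduct :
    Continuous fun p : Vec n × Vec n => p.2.ofLp ⬝ᵥ p.1.ofLp := by
  simp only [dotProduct_ofLp_eq_inner]
  fun_prop

/-- Coercivity comes from boundedness of the cube: `‖u‖² ≤ nL²` and `uᵀx ≤ (‖u‖² + ‖x‖²)/2` give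
`‖u‖² + uᵀx ≤ (3/2)nL² + ‖x‖²/2`. -/
theorem isCoercivePayoff_linear {L : ℝ} (hL : 0 < L) :
    IsCoercivePayoff {v : Vec n | ∀ i, 0 ≤ v i ∧ v i ≤ L} (fun x u => u.ofLp ⬝ᵥ x.ofLp) 1
      (3 / 2 * (n * L ^ 2) + 1 / 2) where
  continuous := continuous_ofLp_dotProduct
  concave x := by
    refine ⟨?_, fun u _ v _ a b _ _ _ => ?_⟩
    · intro u hu v hv a b ha hb hab i
      have h1 := hu i
      have h2 := hv i
      simp only [PiLp.add_apply, PiLp.smul_apply, smul_eq_mul]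
      refine ⟨add_nonneg (mul_nonneg ha h1.1) (mul_nonneg hb h2.1), ?_⟩
      calc a * u i + b * v i ≤ a * L + b * L :=
            add_le_add (mul_le_mul_of_nonneg_left h1.2 ha) (mul_le_mul_of_nonneg_left h2.2 hb)
        _ = L := by rw [← add_mul, hab, one_mul]
    · simp [add_dotProduct]
  zero_mem i := by simp [hL.le]
  zero x := by simp
  pos := one_pos
  coercive x u hu := by
    have h1 : ‖u‖ ^ 2 ≤ n * L ^ 2 := by
      rw [EuclideanSpace.real_norm_sq_eq]
      calc ∑ i, u i ^ 2 ≤ ∑ _i : Fin n, L ^ 2 :=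
            Finset.sum_le_sum fun i _ => pow_le_pow_left₀ (hu i).1 (hu i).2 2
        _ = n * L ^ 2 := by simp
    have h2 : u.ofLp ⬝ᵥ x.ofLp ≤ ‖x‖ * ‖u‖ := by
      rw [dotProduct_ofLp_eq_inner]
      exact real_inner_le_norm x u
    have h3 : 0 ≤ (n * L ^ 2) * ‖x‖ ^ 2 := by positivity
    nlinarith [sq_nonneg (‖x‖ - ‖u‖)]

/-- The constant is the minimum of the form on the compact unit sphere; homogeneity of degree two
does the rest. The sphere is empty when the space is zero. -/
theorem _root_.Matrix.PosDef.exists_mul_norm_sq_le {G : Matrix (Fin n) (Fin n) ℝ}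
    (hG : G.PosDef) : ∃ c : ℝ, 0 < c ∧ ∀ u : Vec n, c * ‖u‖ ^ 2 ≤ u.ofLp ⬝ᵥ (G *ᵥ u.ofLp) := by
  have hcont : Continuous fun u : Vec n => u.ofLp ⬝ᵥ (G *ᵥ u.ofLp) := by
    simp only [dotProduct, mulVec]
    fun_prop
  have hpos : ∀ u : Vec n, u ≠ 0 → 0 < u.ofLp ⬝ᵥ (G *ᵥ u.ofLp) := fun u hu => by
    have := hG.dotProduct_mulVec_pos (x := u.ofLp) (by simpa using hu)
    simpa using this
  rcases (Metric.sphere (0 : Vec n) 1).eq_empty_or_nonempty with h | h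
  · refine ⟨1, one_pos, fun u => ?_⟩
    have hu : u = 0 := by
      by_contra hu
      have : (‖u‖⁻¹ • u) ∈ Metric.sphere (0 : Vec n) 1 := by
        simp [norm_smul, norm_ne_zero_iff.2 hu]
      simp [h] at this
    simp [hu]
  · obtain ⟨w, hw, hmin⟩ := (isCompact_sphere (0 : Vec n) 1).exists_isMinOn h hcont.continuousOn
    refine ⟨_, hpos w (fun h0 => by simp [h0] at hw), fun u => ?_⟩
    by_cases hu : u = 0
    · simp [hu]
    · have hu' : ‖u‖ ≠ 0 := norm_ne_zero_iff.2 hu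
      have := hmin (show (‖u‖⁻¹ • u) ∈ Metric.sphere (0 : Vec n) 1 by simp [norm_smul, hu'])
      simp only [Set.mem_ofPred_eq, WithLp.ofLp_smul, mulVec_smul, smul_dotProduct,
        dotProduct_smul, smul_eq_mul] at this
      calc _ ≤ (‖u‖⁻¹ * (‖u‖⁻¹ * (u.ofLp ⬝ᵥ (G *ᵥ u.ofLp)))) * ‖u‖ ^ 2 := by gcongr
        _ = _ := by field_simp

/-- Concavity: the defect is `ab` times the form at `u - v`. Coercivity: half of the ellipticity
constant `c` absorbs `‖x‖‖u‖` through Young's inequality, the other half remains. -/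
theorem exists_isCoercivePayoff_quadratic {G : Matrix (Fin n) (Fin n) ℝ} (hG : G.PosDef) :
    ∃ c C, IsCoercivePayoff (Set.univ : Set (Vec n))
      (fun x u => u.ofLp ⬝ᵥ x.ofLp - u.ofLp ⬝ᵥ (G *ᵥ u.ofLp)) c C := by
  obtain ⟨c, hc, hle⟩ := hG.exists_mul_norm_sq_le
  refine ⟨c / 2, 1 / (2 * c), ?_, fun x => ⟨convex_univ, fun u _ v _ a b ha hb hab => ?_⟩,
    trivial, fun x => by simp, by positivity, fun x u _ => ?_⟩
  · refine continuous_ofLp_dotProduct.sub ?_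
    simp only [dotProduct, mulVec]
    fun_prop
  · have h1 : 0 ≤ (u - v).ofLp ⬝ᵥ (G *ᵥ (u - v).ofLp) :=
      (mul_nonneg hc.le (sq_nonneg _)).trans (hle (u - v))
    have h2 := mul_nonneg (mul_nonneg ha hb) h1
    obtain rfl : b = 1 - a := by linarith
    simp only [WithLp.ofLp_sub, WithLp.ofLp_add, WithLp.ofLp_smul, mulVec_add, mulVec_sub,
      mulVec_smul, add_dotProduct, sub_dotProduct, dotProduct_add, dotProduct_sub,
      smul_dotProduct, dotProduct_smul, smul_eq_mul] at h2 ⊢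
    linarith
  · have h1 := hle u
    have h2 : u.ofLp ⬝ᵥ x.ofLp ≤ ‖x‖ * ‖u‖ := by
      rw [dotProduct_ofLp_eq_inner]
      exact real_inner_le_norm x u
    have h3 : ‖x‖ * ‖u‖ ≤ c / 2 * ‖u‖ ^ 2 + 1 / (2 * c) * ‖x‖ ^ 2 := by
      have : c / 2 * ‖u‖ ^ 2 + 1 / (2 * c) * ‖x‖ ^ 2 - ‖x‖ * ‖u‖ =
          (c * ‖u‖ - ‖x‖) ^ 2 / (2 * c) := by
        field_simp
        ring
      have h4 : 0 ≤ (c * ‖u‖ - ‖x‖) ^ 2 / (2 * c) := by positivity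
      linarith
    have h5 : 0 ≤ 1 / (2 * c) := by positivity
    simp only
    linarith

end Payoffs

/-! ### Joint measurability, integrability and existence -/

section Existence

variable {Ω : Type*} {mΩ : MeasurableSpace Ω} {n : ℕ} {P : Measure Ω}

theorem exists_measurable_modification {X : ℝ≥0 → Ω → Vec n} (hX : ∀ t, Measurable (X t))
    (hrc : ∀ᵐ ω ∂P, ∀ t, ContinuousWithinAt (fun s => X s ω) (Set.Ici t) t) :
    ∃ Z : ℝ≥0 × Ω → Vec n, Measurable Z ∧ ∀ᵐ ω ∂P, ∀ s, Z (s, ω) = X s ω := by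
  -- `g k s` is the next point to the right of `s` on the grid of mesh `1/(k+1)`. It takes countably
  -- many values, so `X (g k s)` is jointly measurable, and right continuity gives convergence to `X
  -- s` at all times at once.
  set g : ℕ → ℝ≥0 → ℝ≥0 := fun k s => (⌊s * (k + 1)⌋₊ + 1) / (k + 1) with hg
  have hle : ∀ k s, s ≤ g k s := fun k s => by
    rw [hg, le_div_iff₀ (by positivity)]
    exact (Nat.lt_floor_add_one _).le
  have hge : ∀ k s, g k s ≤ s + 1 / (k + 1) := fun k s => by
    have h : (⌊s * (k + 1)⌋₊ : ℝ≥0) ≤ s * (k + 1) := Nat.floor_le zero_le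
    rw [hg]
    dsimp only
    rw [div_le_iff₀ (by positivity), add_mul, one_div, inv_mul_cancel₀ (by positivity)]
    gcongr
  refine ⟨convLimit fun k p => X (g k p.1) p.2, measurable_convLimit fun k => ?_, ?_⟩
  · have h1 : ∀ r : ℕ → ℝ≥0, Measurable fun q : ℕ × Ω => X (r q.1) q.2 := fun r =>
      measurable_from_prod_countable_right fun m => hX (r m)
    have h2 : Measurable fun p : ℝ≥0 × Ω => (⌊p.1 * (k + 1)⌋₊, p.2) :=
      (Nat.measurable_floor.comp (by fun_prop)).prodMk measurable_snd
    have h3 := (h1 fun m => ((m : ℝ≥0) + 1) / (k + 1)).comp h2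
    simp only [Function.comp_def] at h3
    simp only [hg]
    exact h3
  · filter_upwards [hrc] with ω hω s
    refine convLimit_eq ((hω s).tendsto.comp (tendsto_nhdsWithin_iff.2 ⟨?_, ?_⟩))
    · refine tendsto_of_tendsto_of_tendsto_of_le_of_le tendsto_const_nhds ?_
        (fun k => hle k s) (fun k => hge k s)
      have h := (tendsto_const_nhds (x := s)).add
        (tendsto_one_div_add_atTop_nhds_zero_nat (𝕜 := ℝ≥0))
      simpa using h
    · exact Filter.Eventually.of_forall fun k => hle k s

/-- Along each path the bound is at most `C(1 + sup ‖X‖²)` over a time at most `T`. Only constants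
are split off the integral, so measurability of the uncountable supremum is not needed. -/
theorem lintegral_payoffBound_ne_top [IsFiniteMeasure P] {T : ℝ≥0} {τ : Ω → ℝ≥0} (C : ℝ)
    {X : ℝ≥0 → Ω → Vec n} {Z : ℝ≥0 × Ω → Vec n} (hZX : ∀ᵐ ω ∂P, ∀ s, Z (s, ω) = X s ω)
    (hsq : ∫⁻ ω, (⨆ s : Set.Icc (0 : ℝ≥0) T, ‖X s ω‖ₑ ^ 2) ∂P < ∞) :
    ∫⁻ ω, timeIntegral T τ (payoffBound C Z) ω ∂P ≠ ∞ := by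
  have hle : ∀ᵐ ω ∂P, timeIntegral T τ (payoffBound C Z) ω ≤
      ENNReal.ofReal C * (1 + ⨆ s : Set.Icc (0 : ℝ≥0) T, ‖X s ω‖ₑ ^ 2) * T := by
    filter_upwards [hZX] with ω hω
    have h1 : ∀ s ∈ Set.Icc (τ ω : ℝ) (T : ℝ), payoffBound C Z (s.toNNReal, ω) ≤
        ENNReal.ofReal C * (1 + ⨆ s : Set.Icc (0 : ℝ≥0) T, ‖X s ω‖ₑ ^ 2) := by
      intro s hs
      rw [payoffBound, ENNReal.ofReal_mul' (by positivity), ENNReal.ofReal_add zero_le_one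
        (by positivity), ENNReal.ofReal_one, ENNReal.ofReal_pow (norm_nonneg _), ofReal_norm, hω]
      gcongr
      exact le_iSup (fun s : Set.Icc (0 : ℝ≥0) T => ‖X s ω‖ₑ ^ 2)
        ⟨s.toNNReal, zero_le, (toNNReal_mem_Icc hs).2⟩
    calc timeIntegral T τ (payoffBound C Z) ω
        ≤ ∫⁻ _s in Set.Icc (τ ω : ℝ) (T : ℝ),
          ENNReal.ofReal C * (1 + ⨆ s : Set.Icc (0 : ℝ≥0) T, ‖X s ω‖ₑ ^ 2) :=
          setLIntegral_mono' measurableSet_Icc h1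
      _ ≤ _ := by
        rw [setLIntegral_const, Real.volume_Icc]
        gcongr
        rw [← ENNReal.ofReal_coe_nnreal]
        exact ENNReal.ofReal_le_ofReal (by simp)
  refine ne_top_of_le_ne_top ?_ (lintegral_mono_ae hle)
  rw [lintegral_mul_const' _ _ (by simp), lintegral_const_mul' _ _ (by simp),
    lintegral_add_left measurable_const]
  refine ENNReal.mul_ne_top (ENNReal.mul_ne_top (by simp) (ENNReal.add_ne_top.2 ⟨?_, hsq.ne⟩))
    (by simp)
  simp

theorem payoff_congr {f : Vec n → Vec n → ℝ≥0 → ℝ} {X X' : ℝ≥0 → Ω → Vec n} {T : ℝ≥0}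
    {τ : Ω → ℝ≥0} {u u' : ℝ≥0 → Ω → Vec n} {ω : Ω} (hX : ∀ s, X s ω = X' s ω)
    (hu : ∀ s, τ ω ≤ s → s ≤ T → u s ω = u' s ω) : payoff f X T τ u ω = payoff f X' T τ u' ω := by
  refine extIntegral_congr_ae ((ae_restrict_iff' measurableSet_Icc).2 (Filter.Eventually.of_forall
    fun s hs => ?_))
  simp only [hX, hu _ (toNNReal_mem_Icc hs).1 (toNNReal_mem_Icc hs).2]

/-- Existence of an optimal control for concave coercive running payoffs. -/
theorem IsCoercivePayoff.exists_optimal [IsFiniteMeasure P] {K Γ : Set (Vec n)}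
    {φ : Vec n → Vec n → ℝ} {c C : ℝ} (hφ : IsCoercivePayoff K φ c C) (hK : IsClosed K)
    (hΓc : IsClosed Γ) (hΓ : Convex ℝ Γ) {𝓕 : Filtration ℝ≥0 mΩ} {T : ℝ≥0}
    {X : ℝ≥0 → Ω → Vec n} (hX : ∀ t, Measurable (X t))
    (hrc : ∀ᵐ ω ∂P, ∀ t, ContinuousWithinAt (fun s => X s ω) (Set.Ici t) t)
    (hsq : ∫⁻ ω, (⨆ s : Set.Icc (0 : ℝ≥0) T, ‖X s ω‖ₑ ^ 2) ∂P < ∞) {τ : Ω → ℝ≥0}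
    (hτ : IsStoppingTime 𝓕 (fun ω => (τ ω : WithTop ℝ≥0))) {Y : Ω → Vec n}
    (hY : ∀ᵐ ω ∂P, Y ω ∈ Γ) :
    ∃ v, IsAdmissible P 𝓕 T Γ K τ Y v ∧ ∀ u, IsAdmissible P 𝓕 T Γ K τ Y u →
      extCondExp hτ.measurableSpace P (payoff (fun x u _ => φ x u) X T τ u) ≤ᵐ[P]
          extCondExp hτ.measurableSpace P (payoff (fun x u _ => φ x u) X T τ v) ∧
        extIntegral P (payoff (fun x u _ => φ x u) X T τ u) ≤
          extIntegral P (payoff (fun x u _ => φ x u) X T τ v) := by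
  obtain ⟨Z, hZ, hZX⟩ := exists_measurable_modification hX hrc
  have hτm : Measurable τ := by
    refine measurable_of_Iic fun t => 𝓕.le t _ ?_
    have h := hτ t
    simp only [WithTop.coe_le_coe] at h
    exact h
  have hD := lintegral_payoffBound_ne_top (τ := τ) C hZX hsq
  obtain ⟨v, hv, hfin, hmin⟩ := hφ.exists_isMinOn (𝓕 := 𝓕) hZ hτm hK (hφ.concave 0).1 hΓc hΓ hY hD
  refine ⟨fun s ω => v (s, ω), hv.isAdmissible hτm, fun u hu => ?_⟩
  obtain ⟨w, hw, hwu⟩ := hu.exists_isControl hφ.zero_mem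
  have hpu : payoff (fun x u _ => φ x u) X T τ u =ᵐ[P]
      payoff (fun x u _ => φ x u) (fun s ω => Z (s, ω)) T τ (fun s ω => w (s, ω)) := by
    filter_upwards [hZX] with ω hω
    exact payoff_congr (fun s => (hω s).symm) fun s h1 h2 => (hwu ω s h1 h2).symm
  have hpv : payoff (fun x u _ => φ x u) X T τ (fun s ω => v (s, ω)) =ᵐ[P]
      payoff (fun x u _ => φ x u) (fun s ω => Z (s, ω)) T τ (fun s ω => v (s, ω)) := by
    filter_upwards [hZX] with ω hω
    exact payoff_congr (fun s => (hω s).symm) fun _ _ _ => rfl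
  obtain ⟨hv1, hv2⟩ := hφ.payoff_decomposition (m := hτ.measurableSpace) hZ hτm hv.measurable
    hv.mem hD
  obtain ⟨hw1, hw2⟩ := hφ.payoff_decomposition (m := hτ.measurableSpace) hZ hτm hw.measurable
    hw.mem hD
  constructor
  · filter_upwards [extCondExp_congr_ae hτ.measurableSpace hpu,
      extCondExp_congr_ae hτ.measurableSpace hpv, hv1, hw1,
      condLExp_loss_le hτ hv hfin hmin hw] with ω h1 h2 h3 h4 h5
    rw [h1, h2, h3, h4]
    exact EReal.sub_le_sub le_rfl (EReal.coe_ennreal_le_coe_ennreal_iff.2 h5)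
  · rw [extIntegral_congr_ae hpu, extIntegral_congr_ae hpv, hv2, hw2]
    exact EReal.sub_le_sub le_rfl (EReal.coe_ennreal_le_coe_ennreal_iff.2 (hmin w hw))

theorem constraintSet_eq_preimage (Γ₀ : Set (Vec n)) (g : Vec n) :
    constraintSet Γ₀ g = (fun y => y - g) ⁻¹' Γ₀ := by
  ext y
  constructor
  · rintro ⟨x, hx, rfl⟩
    simpa using hx
  · exact fun h => ⟨y - g, h, by simp⟩

theorem IsConstraintCone.isClosed_constraintSet {Γ₀ : Set (Vec n)} (h : IsConstraintCone Γ₀)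
    (g : Vec n) : IsClosed (constraintSet Γ₀ g) := by
  rw [constraintSet_eq_preimage]
  exact h.isClosed.preimage (by fun_prop)

theorem IsConstraintCone.convex_constraintSet {Γ₀ : Set (Vec n)} (h : IsConstraintCone Γ₀)
    (g : Vec n) : Convex ℝ (constraintSet Γ₀ g) := by
  rintro _ ⟨x, hx, rfl⟩ _ ⟨y, hy, rfl⟩ a b ha hb hab
  refine ⟨_, h.convex hx hy ha hb hab, ?_⟩
  obtain rfl : b = 1 - a := by linarith
  module

theorem exists_isCoercivePayoff {K : Set (Vec n)} {f : Vec n → Vec n → ℝ≥0 → ℝ}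
    (hKf : IsLinearCase K f ∨ IsQuadraticCase K f) :
    ∃ φ c C, f = (fun x u _ => φ x u) ∧ IsCoercivePayoff K φ c C ∧ IsClosed K := by
  rcases hKf with ⟨L, hL, rfl, hf⟩ | ⟨G, hG, rfl, hf⟩
  · refine ⟨_, _, _, funext fun x => funext fun u => funext fun t => hf x u t,
      isCoercivePayoff_linear hL, ?_⟩
    simp only [Set.ofPred_forall, Set.ofPred_and]
    exact isClosed_iInter fun i => (isClosed_le (by fun_prop) (by fun_prop)).inter
      (isClosed_le (by fun_prop) (by fun_prop))
  · obtain ⟨c, C, h⟩ := exists_isCoercivePayoff_quadratic hG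
    exact ⟨_, c, C, funext fun x => funext fun u => funext fun t => hf x u t, h, isClosed_univ⟩

end Existence

end SwingControl

theorem lemma1 {Ω : Type*} {mΩ : MeasurableSpace Ω} (P : Measure Ω) [IsProbabilityMeasure P]
    (n : ℕ) (hn : 0 < n) (T : ℝ≥0) (hT : 0 < T)
    (X : ℝ≥0 → Ω → SwingControl.Vec n) (hX : ∀ t, StronglyMeasurable (X t))
    (hrcll : ∀ᵐ ω ∂P, SwingControl.IsRCLL (fun t => X t ω))
    (hsq : ∫⁻ ω, (⨆ s : Set.Icc (0 : ℝ≥0) T, ‖X s ω‖ₑ ^ 2) ∂P < ∞)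
    (hpos : ∀ t i, ∀ᵐ ω ∂P, 0 ≤ X t ω i)
    (Γ₀ : Set (SwingControl.Vec n)) (hΓ₀ : SwingControl.IsConstraintCone Γ₀)
    (g : SwingControl.Vec n) (hg : ∀ i, 0 < g i)
    (K : Set (SwingControl.Vec n))
    (f : SwingControl.Vec n → SwingControl.Vec n → ℝ≥0 → ℝ)
    (hKf : SwingControl.IsLinearCase K f ∨ SwingControl.IsQuadraticCase K f)
    (τ : Ω → ℝ≥0)
    (hτ : IsStoppingTime (Filtration.natural X hX) (fun ω => (τ ω : WithTop ℝ≥0)))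
    (hτT : ∀ ω, τ ω ≤ T)
    (Y : Ω → SwingControl.Vec n) (hY : Measurable[hτ.measurableSpace] Y)
    (hYΓ : ∀ᵐ ω ∂P, Y ω ∈ SwingControl.constraintSet Γ₀ g) :
    ∃ ubar : ℝ≥0 → Ω → SwingControl.Vec n,
      SwingControl.IsAdmissible P (Filtration.natural X hX) T
        (SwingControl.constraintSet Γ₀ g) K τ Y ubar ∧
      SwingControl.IsEssSupFamily P
        {h | ∃ u, SwingControl.IsAdmissible P (Filtration.natural X hX) T
              (SwingControl.constraintSet Γ₀ g) K τ Y u ∧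
            h = SwingControl.extCondExp hτ.measurableSpace P (SwingControl.payoff f X T τ u)}
        (SwingControl.extCondExp hτ.measurableSpace P (SwingControl.payoff f X T τ ubar)) ∧
      ∀ u, SwingControl.IsAdmissible P (Filtration.natural X hX) T
          (SwingControl.constraintSet Γ₀ g) K τ Y u →
        SwingControl.extIntegral P (SwingControl.payoff f X T τ u) ≤
          SwingControl.extIntegral P (SwingControl.payoff f X T τ ubar) := by
  obtain ⟨φ, c, C, rfl, hφ, hK⟩ := SwingControl.exists_isCoercivePayoff hKf
  obtain ⟨v, hv, hopt⟩ := hφ.exists_optimal hK (hΓ₀.isClosed_constraintSet g)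
    (hΓ₀.convex_constraintSet g) (fun t => (hX t).measurable)
    (hrcll.mono fun ω h t => (h t).1) hsq hτ hYΓ
  refine ⟨v, hv, ⟨SwingControl.measurable_extCondExp _ _ _, ?_, ?_⟩, fun u hu => (hopt u hu).2⟩
  · rintro _ ⟨u, hu, rfl⟩
    exact (hopt u hu).1
  -- The optimal value itself belongs to the family, so every upper bound dominates it.
  · exact fun g' _ h => h _ ⟨v, hv, rfl⟩
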